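/- Theorem. An admissible pair in $\mathbb{R}$ is a pair $(N,B)$ where $N$ is an integer with $|N|>1$ and $B\subset\mathbb{Z}$ is a finite set with $\#B\ge 2$ such that, for some $L\subset\mathbb{Z}$ with $\#L=\#B$, the matrix $$\Big[\tfrac{1}{\sqrt{\#B}}\,e^{-2\pi i\,b\ell/N}\Big]_{b\in B,\ \ell\in L}$$ is unitary. Let $\{(N_n,B_n)\}_{n=1}^\infty$ be a sequence of admissible pairs in $\mathbb{R}$ with $N_n>0$ for all $n$, satisfying the remainder bounded condition (RBC) $$\sum_{n=1}^\infty\frac{\#\big(B_n\setminus\{0,1,\dots,N_n-1\}\big)}{\#B_n}<\infty .$$ Suppose that there are a strictly increasing sequence $\{n_k\}_{k=1}^\infty$ of positive integers and a number $l\in(0,1)$ such that the subsequence $\{(N_{n_k},B_{n_k})\}_{k=1}^\infty$ satisfies the partial concentration condition (PCC), that is, at least one of the following holds: (i) there are real numbers $u_k,v_k\in[0,N_{n_k}-1]$, $k\ge1$, with $0<\frac{v_k-u_k}{N_{n_k}}<l$ for all $k$ and $$\sum_{k=1}^\infty\frac{\#\big(B_{n_k}\setminus[u_k,v_k]\big)}{\#B_{n_k}}<\infty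 ;$$ (ii) there are $c\in(0,1]$ and real numbers $u_k,v_k\in\big[\tfrac l2N_{n_k},(1-\tfrac l2)N_{n_k}\big]$, $k\ge1$, with $$\frac{\#\big(B_{n_k}\cap[u_k,v_k]\big)}{\#B_{n_k}}\ge c\qquad\text{for all }k\ge1 .$$ For a finite set $A\subset\mathbb{R}$ write $\delta_A=\frac1{\#A}\sum_{a\in A}\delta_a$, where $\delta_a$ is the Dirac measure at $a$. Then the measures $$\mu_n=\delta_{N_1^{-1}B_1}*\delta_{(N_2N_1)^{-1}B_2}*\cdots*\delta_{(N_n\cdots N_2N_1)^{-1}B_n}$$ converge weakly, as $n\to\infty$, to a Borel probability measure $\mu$ on $\mathbb{R}$ (the infinite convolution exists), and $\mu$ is a spectral measure: there is a countable set $\Lambda\subset\mathbb{R}$ such that the functions $x\mapsto e^{-2\pi i\lambda x}$, $\lambda\in\Lambda$, form an orthonormal basis of $L^2(\mu)$. -/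

import Mathlib

open MeasureTheory Filter Topology
open scoped ENNReal

/-- The uniform probability measure `δ_A = (1 / #A) ∑_{a ∈ A} δ_a` on a finite set `A ⊆ ℝ`. -/
noncomputable def uniformDiscrete (A : Finset ℝ) : Measure ℝ :=
  (A.card : ℝ≥0∞)⁻¹ • ∑ a ∈ A, Measure.dirac a

/-- The `b`-`ℓ` matrix `(#B)^{-1/2} exp(-2πi (b / N) ℓ)`, with `b ∈ B` and `ℓ ∈ L`. -/
noncomputable def hadamardMatrix (N : ℤ) (B L : Finset ℤ) : Matrix B L ℂ :=
  fun b l => ((1 / Real.sqrt (B.card : ℝ) : ℝ) : ℂ) *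
    Complex.exp (-2 * Real.pi * Complex.I * (((b : ℤ) : ℂ) / (N : ℂ)) * ((l : ℤ) : ℂ))

/-- `(N, B)` is an admissible pair in `ℝ`: `N` is an integer with `|N| > 1`, `B ⊆ ℤ` is finite with
at least two elements, and for some `L ⊆ ℤ` with `#L = #B` the matrix above is unitary. (Its rows
and columns have different index types, so unitarity is spelled out as two matrix identities.) -/
def IsAdmissiblePair (N : ℤ) (B : Finset ℤ) : Prop :=
  1 < |N| ∧ 2 ≤ B.card ∧ ∃ L : Finset ℤ, B.card = L.card ∧
    hadamardMatrix N B L * (hadamardMatrix N B L).conjTranspose = 1 ∧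
    (hadamardMatrix N B L).conjTranspose * hadamardMatrix N B L = 1

/-- The finite set `(N_1 ⋯ N_n)⁻¹ B_n`. Sequences are indexed from `0` in the code, so that `N n`
and `B n` are the terms number `n + 1`. -/
noncomputable def scaledDigits (N : ℕ → ℤ) (B : ℕ → Finset ℤ) (n : ℕ) : Finset ℝ :=
  (B n).image fun b : ℤ => (b : ℝ) / ∏ i ∈ Finset.range (n + 1), (N i : ℝ)

/-- The convolution of the first `n` of the measures `δ_{(N_1 ⋯ N_k)⁻¹ B_k}`
(for `n = 0` the Dirac mass at `0`). -/
noncomputable def partialConvolution (N : ℕ → ℤ) (B : ℕ → Finset ℤ) : ℕ → Measure ℝ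
  | 0 => Measure.dirac 0
  | n + 1 => (partialConvolution N B n).conv (uniformDiscrete (scaledDigits N B n))

/-- `μ` is the infinite convolution of `(N_n, B_n)`: the partial convolutions are probability
measures which converge weakly to the Borel probability measure `μ`. -/
def IsInfiniteConvolution (N : ℕ → ℤ) (B : ℕ → Finset ℤ) (μ : ProbabilityMeasure ℝ) : Prop :=
  ∃ h : ∀ n, IsProbabilityMeasure (partialConvolution N B n),
    Tendsto (β := ProbabilityMeasure ℝ) (fun n => ⟨partialConvolution N B n, h n⟩) atTop (𝓝 μ)

/-- `μ` is a spectral measure: for some countable `Λ ⊆ ℝ` the exponentials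
`x ↦ exp(-2πi t x)`, `t ∈ Λ`, form an orthonormal (Hilbert) basis of `L²(μ)`. -/
def IsSpectralMeasure (μ : Measure ℝ) : Prop :=
  ∃ Λ : Set ℝ, Λ.Countable ∧ ∃ e : HilbertBasis Λ ℂ (Lp ℂ 2 μ),
    ∀ t : Λ, (e t : ℝ → ℂ) =ᵐ[μ] fun x : ℝ =>
      Complex.exp (-2 * Real.pi * Complex.I * ((t : ℝ) : ℂ) * (x : ℂ))

/-- The remainder bounded condition: `∑ #B_{n,2} / #B_n < ∞`, where
`B_{n,2} = B_n ∖ {0, 1, …, N_n - 1}`. -/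
def RemainderBounded (N : ℕ → ℤ) (B : ℕ → Finset ℤ) : Prop :=
  Summable fun n => ((B n \ Finset.Ico 0 (N n)).card : ℝ) / ((B n).card : ℝ)

/-- The set `B ∩ [u, v]`, where `u` and `v` are real. -/
noncomputable def digitsIn (B : Finset ℤ) (u v : ℝ) : Finset ℤ :=
  B.filter fun b => u ≤ (b : ℝ) ∧ (b : ℝ) ≤ v

/-- The partial concentration condition with parameter `l`, case (i). -/
def PartialConcentrationOne (l : ℝ) (N : ℕ → ℤ) (B : ℕ → Finset ℤ) : Prop :=
  ∃ u v : ℕ → ℝ,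
    (∀ n, u n ∈ Set.Icc 0 ((N n : ℝ) - 1) ∧ v n ∈ Set.Icc 0 ((N n : ℝ) - 1) ∧
      0 < (v n - u n) / (N n : ℝ) ∧ (v n - u n) / (N n : ℝ) < l) ∧
    Summable fun n => ((B n \ digitsIn (B n) (u n) (v n)).card : ℝ) / ((B n).card : ℝ)

/-- The partial concentration condition with parameter `l`, case (ii). -/
def PartialConcentrationTwo (l : ℝ) (N : ℕ → ℤ) (B : ℕ → Finset ℤ) : Prop :=
  ∃ c ∈ Set.Ioc (0 : ℝ) 1, ∃ u v : ℕ → ℝ, ∀ n,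
    u n ∈ Set.Icc (l / 2 * (N n : ℝ)) ((1 - l / 2) * (N n : ℝ)) ∧
    v n ∈ Set.Icc (l / 2 * (N n : ℝ)) ((1 - l / 2) * (N n : ℝ)) ∧
    c ≤ ((digitsIn (B n) (u n) (v n)).card : ℝ) / ((B n).card : ℝ)

/-- The partial concentration condition: for some `l ∈ (0, 1)`, case (i) or case (ii) holds. -/
def PartialConcentration (N : ℕ → ℤ) (B : ℕ → Finset ℤ) : Prop :=
  ∃ l ∈ Set.Ioo (0 : ℝ) 1, PartialConcentrationOne l N B ∨ PartialConcentrationTwo l N B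

/-!
Write `m_B(t) = (1 / #B) ∑_{b ∈ B} exp(-2πi b t)` for the mask of a digit set, `P_n = N_0 ⋯ N_{n-1}`
and `F_n(ξ) = ∏_{i < n} m_{B_i}(ξ / P_{i+1})` for the Fourier transform of the `n`-th partial
convolution. The whole argument takes place on the Fourier side.

*Existence.* A digit in `{0, …, N - 1}` contributes at most `2π|ξ|` to `1 - m_B(ξ / N)`, so the
remainder bounded condition makes `∑ |F_{n+1} - F_n|` converge locally uniformly. The limit is
continuous, and Lévy's and Prokhorov's theorems give the measure `μ`
(`exists_isInfiniteConvolution`).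

*Spectral criterion.* If `∑_{t ∈ Λ} |μ̂(ξ + t)|² = 1` for all `ξ`, then `Λ` is a spectrum of `μ`:
the values `ξ = -t` give orthonormality, the others put every exponential into the closed span, and
exponentials are total in `L²(μ)` (`isSpectralMeasure_of_hasSum`).

*Finite levels.* Unitarity of the Hadamard matrix is the identity `∑_{ℓ ∈ L} |m_B(t + ℓ/N)|² = 1`.
It yields an increasing sequence of finite sets `Λ_j ⊆ ℤ` with
`∑_{λ ∈ Λ_j} |F_{M_j}(ξ + λ)|² = 1`, and since `F_n` is `P_n`-periodic the elements of `Λ_j` can be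
taken to be the residues modulo `P_{M_j}` of least absolute value (`exists_isLevelSpectrum_seq`).

*Passing to the limit.* What is needed is that no mass escapes, and it is enough that `|F_n(ξ)| ≥
ε |F_M(ξ)|` for `n > M`, for `|ξ| ≤ (1/2 + δ) P_M`, and for infinitely many `M`
(`exists_mul_norm_maskProd_le`); then the sums converge by domination
(`hasSum_indicator_of_isLevelSpectrum`). The quotient `F_n / F_M` is the product of `m_{B_M}(x /
N_M)`, where `x = ξ / P_M`, and a tail evaluated at points of size at most `|x| / 2, |x| / 4, …`.
The tail is bounded below because all but a small proportion of the digits lie within `N / 2` of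
`N / 2` (`quarter_le_norm_prod_Ico`). The first factor is bounded below along the subsequence by
the partial concentration condition (`PartialConcentration.exists_le_norm_mask`): after a
rotation, its real part is an average of the numbers `cos(2πx(b - a)/N)`, and for `|x| ≤ 1/2`
these are nonnegative for the digits in `{0, …, N - 1}` if `a = N / 2`; if a fixed proportion of
the digits avoids neighbourhoods of `0` and `N`, or if almost all digits lie in an interval of
length `< l N` with centre `a`, the average stays away from `0`.
-/

/-! ### The mask of a digit set -/

/-- The mask `t ↦ (1 / #B) ∑_{b ∈ B} exp(-2πi b t)` of a digit set `B`. The exponents are written as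
a real number times `I`, so that the lemmas on `exp (x * I)` with `x` real apply. -/
noncomputable def mask (B : Finset ℤ) (t : ℝ) : ℂ :=
  (B.card : ℂ)⁻¹ * ∑ b ∈ B, Complex.exp (((-(2 * Real.pi * t) * b : ℝ) : ℂ) * Complex.I)

lemma norm_mask_le_one (B : Finset ℤ) (t : ℝ) : ‖mask B t‖ ≤ 1 := by
  rw [mask, norm_mul, norm_inv, Complex.norm_natCast]
  rcases B.eq_empty_or_nonempty with rfl | hB
  · simp
  have h : ‖∑ b ∈ B, Complex.exp (((-(2 * Real.pi * t) * b : ℝ) : ℂ) * Complex.I)‖ ≤ B.card := by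
    refine (norm_sum_le _ _).trans ?_
    simp only [Complex.norm_exp_ofReal_mul_I, Finset.sum_const, nsmul_eq_mul, mul_one, le_refl]
  have : (0 : ℝ) < B.card := by exact_mod_cast hB.card_pos
  rw [inv_mul_le_iff₀ this]
  simpa using h

lemma mask_zero {B : Finset ℤ} (hB : B.Nonempty) : mask B 0 = 1 := by
  have : (B.card : ℂ) ≠ 0 := by exact_mod_cast hB.card_pos.ne'
  simp [mask, this]

lemma mask_add_intCast (B : Finset ℤ) (t : ℝ) (k : ℤ) : mask B (t + k) = mask B t := by
  unfold mask
  congr 1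
  refine Finset.sum_congr rfl fun b _ => ?_
  rw [Complex.exp_eq_exp_iff_exists_int]
  refine ⟨-(k * b), ?_⟩
  push_cast
  ring

lemma continuous_mask (B : Finset ℤ) : Continuous (mask B) := by
  unfold mask
  fun_prop

/-- The Parseval identity for the unitary matrix of an admissible pair, applied to the normalized
vector `(exp(-2πi b t))_b`. As it holds for all `t`, the frequency set `L` may be translated, hence
assumed to contain `0`. -/
lemma IsAdmissiblePair.exists_sum_norm_mask_sq {N : ℤ} {B : Finset ℤ} (h : IsAdmissiblePair N B) :
    ∃ L : Finset ℤ, 0 ∈ L ∧ ∀ t : ℝ, ∑ ℓ ∈ L, ‖mask B (t + ℓ / N)‖ ^ 2 = 1 := by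
  obtain ⟨-, hB, L, hL, hH, -⟩ := h
  have hpars : ∀ t : ℝ, ∑ ℓ ∈ L, ‖mask B (t + ℓ / N)‖ ^ 2 = 1 := by
    intro t
    set H := hadamardMatrix N B L with hHdef
    set s : ℝ := 1 / Real.sqrt (B.card : ℝ) with hs
    have hcard : (0 : ℝ) < B.card := by exact_mod_cast (by omega : 0 < B.card)
    have hss : s * s = (B.card : ℝ)⁻¹ := by
      rw [hs, div_mul_div_comm, Real.mul_self_sqrt hcard.le]; simp
    set v : B → ℂ := fun b =>
      (s : ℂ) * Complex.exp (((-(2 * Real.pi * t) * (b : ℤ) : ℝ) : ℂ) * Complex.I) with hv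
    have hmask : ∀ ℓ : L, mask B (t + (ℓ : ℤ) / N) = Matrix.vecMul v H ℓ := by
      intro ℓ
      have hss' : ((B.card : ℂ))⁻¹ = (s : ℂ) * s := by
        rw [← Complex.ofReal_mul, hss]; simp
      rw [mask, ← Finset.sum_coe_sort, Finset.mul_sum, Matrix.vecMul, dotProduct]
      refine Finset.sum_congr rfl fun b _ => ?_
      rw [hHdef, hadamardMatrix, hv, hss']
      dsimp only
      rw [mul_mul_mul_comm, ← Complex.exp_add]
      congr 2
      push_cast
      ring
    have hsum : ∑ ℓ ∈ L, ‖mask B (t + ℓ / N)‖ ^ 2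
        = ∑ ℓ : L, ‖Matrix.vecMul v H ℓ‖ ^ 2 := by
      rw [← Finset.sum_coe_sort]
      exact Finset.sum_congr rfl fun ℓ _ => by rw [hmask]
    rw [hsum]
    have hnorm : ∀ {ι : Type} [Fintype ι] (w : ι → ℂ),
        ((∑ i, ‖w i‖ ^ 2 : ℝ) : ℂ) = dotProduct w (star w) := by
      intro ι _ w
      rw [dotProduct]
      push_cast
      exact Finset.sum_congr rfl fun i _ => (Complex.mul_conj' _).symm
    have hv1 : (∑ b : B, ‖v b‖ ^ 2 : ℝ) = 1 := by
      have : ∀ b : B, ‖v b‖ ^ 2 = (B.card : ℝ)⁻¹ := by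
        intro b
        rw [hv]
        dsimp only
        rw [norm_mul, Complex.norm_exp_ofReal_mul_I, mul_one, Complex.norm_real, Real.norm_eq_abs,
          sq_abs, sq, hss]
      rw [Finset.sum_congr rfl fun b _ => this b]
      simp [hcard.ne']
    apply Complex.ofReal_injective
    rw [← hv1, hnorm, hnorm, Matrix.star_vecMul, Matrix.dotProduct_mulVec, Matrix.vecMul_vecMul, hH,
      Matrix.vecMul_one]
  have hLne : L.Nonempty := Finset.card_pos.mp (by omega)
  obtain ⟨ℓ₀, hℓ₀⟩ := hLne
  refine ⟨L.image fun ℓ => ℓ - ℓ₀, Finset.mem_image.mpr ⟨ℓ₀, hℓ₀, sub_self _⟩, fun t => ?_⟩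
  rw [Finset.sum_image fun a _ b _ hab => sub_left_injective hab, ← hpars (t - ℓ₀ / N)]
  refine Finset.sum_congr rfl fun ℓ _ => ?_
  congr 3
  push_cast
  ring

/-- An average over `B` is at most a bound for the terms in a set `G` of good digits plus a bound
for all terms times the proportion of the digits outside `G`. -/
lemma average_le_of_le {B : Finset ℤ} (G : Finset ℤ) {f : ℤ → ℝ} {α β : ℝ} (hα : 0 ≤ α)
    (hG : ∀ b ∈ B, b ∈ G → f b ≤ α) (hB : ∀ b ∈ B, f b ≤ β) :
    (∑ b ∈ B, f b) / B.card ≤ α + β * (((B \ G).card : ℝ) / B.card) := by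
  rcases B.eq_empty_or_nonempty with rfl | hne
  · simpa using hα
  have hcard : (0 : ℝ) < B.card := by exact_mod_cast hne.card_pos
  rw [div_le_iff₀ hcard, add_mul, mul_assoc, div_mul_cancel₀ _ hcard.ne']
  rw [← Finset.sum_inter_add_sum_sdiff B G]
  have h1 : ∑ b ∈ B ∩ G, f b ≤ (B ∩ G).card * α := by
    rw [← nsmul_eq_mul]
    refine Finset.sum_le_card_nsmul _ _ _ fun b hb => ?_
    rw [Finset.mem_inter] at hb
    exact hG b hb.1 hb.2
  have h2 : ∑ b ∈ B \ G, f b ≤ (B \ G).card * β := by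
    rw [← nsmul_eq_mul]
    exact Finset.sum_le_card_nsmul _ _ _ fun b hb => hB b (Finset.sdiff_subset hb)
  have h3 : ((B ∩ G).card : ℝ) ≤ B.card := by
    exact_mod_cast Finset.card_le_card Finset.inter_subset_left
  nlinarith [mul_le_mul_of_nonneg_right h3 hα]

lemma le_average_of_le {B : Finset ℤ} (hne : B.Nonempty) (G : Finset ℤ) {f : ℤ → ℝ} {α : ℝ}
    (hα : α ≤ 1) (hG : ∀ b ∈ B, b ∈ G → α ≤ f b) (hB : ∀ b ∈ B, -1 ≤ f b) :
    α - 2 * (((B \ G).card : ℝ) / B.card) ≤ (∑ b ∈ B, f b) / B.card := by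
  have hcard : (0 : ℝ) < B.card := by exact_mod_cast hne.card_pos
  have h := average_le_of_le (B := B) G (f := fun b => 1 - f b) (α := 1 - α) (β := 2)
    (by linarith) (fun b hb hbG => by linarith [hG b hb hbG]) (fun b hb => by linarith [hB b hb])
  have h' : (∑ b ∈ B, (1 - f b)) / (B.card : ℝ) = 1 - (∑ b ∈ B, f b) / B.card := by
    rw [Finset.sum_sub_distrib, sub_div]
    simp [hcard.ne']
  rw [h'] at h
  linarith

/-- The real part of `m_B(t)` rotated by `exp(2πi t a)` bounds `|m_B(t)|` from below; the centre `a`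
is at our disposal. -/
lemma average_cos_le_norm_mask (B : Finset ℤ) (t a : ℝ) :
    (∑ b ∈ B, Real.cos (2 * Real.pi * t * (b - a))) / B.card ≤ ‖mask B t‖ := by
  have h : (Complex.exp (((2 * Real.pi * t * a : ℝ) : ℂ) * Complex.I) * mask B t).re
      = (∑ b ∈ B, Real.cos (2 * Real.pi * t * (b - a))) / B.card := by
    rw [mask, mul_left_comm, Finset.mul_sum, div_eq_inv_mul]
    have : ((B.card : ℂ))⁻¹ = (((B.card : ℝ)⁻¹ : ℝ) : ℂ) := by simp
    rw [this, Complex.re_ofReal_mul, Complex.re_sum]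
    congr 1
    refine Finset.sum_congr rfl fun b _ => ?_
    rw [← Complex.exp_add, ← add_mul, ← Complex.ofReal_add, Complex.exp_ofReal_mul_I_re,
      ← Real.cos_neg]
    congr 1
    ring
  rw [← h]
  refine (Complex.re_le_norm _).trans ?_
  rw [norm_mul, Complex.norm_exp_ofReal_mul_I, one_mul]

lemma cos_sub_le_norm_mask {B : Finset ℤ} (hne : B.Nonempty) (G : Finset ℤ) {t a θ : ℝ}
    (hθ : θ ≤ Real.pi) (hG : ∀ b ∈ B, b ∈ G → |2 * Real.pi * t * (b - a)| ≤ θ) :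
    Real.cos θ - 2 * (((B \ G).card : ℝ) / B.card) ≤ ‖mask B t‖ := by
  refine (le_average_of_le hne G (Real.cos_le_one θ) (fun b hb hbG => ?_)
    fun b _ => Real.neg_one_le_cos _).trans (average_cos_le_norm_mask B t a)
  rw [← Real.cos_abs (2 * Real.pi * t * (b - a))]
  exact Real.cos_le_cos_of_nonneg_of_le_pi (abs_nonneg _) hθ (hG b hb hbG)

lemma norm_mask_add_sub_mask_le {N : ℤ} (hN : 0 < N) (B : Finset ℤ) (x y : ℝ) :
    ‖mask B ((x + y) / N) - mask B (x / N)‖ ≤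
      2 * Real.pi * |y| + 2 * (((B \ Finset.Ico 0 N).card : ℝ) / B.card) := by
  have hN' : (0 : ℝ) < N := by exact_mod_cast hN
  have hpi := Real.pi_pos
  set f : ℤ → ℝ := fun b =>
    ‖Complex.exp (((-(2 * Real.pi * ((x + y) / N)) * b : ℝ) : ℂ) * Complex.I)
      - Complex.exp (((-(2 * Real.pi * (x / N)) * b : ℝ) : ℂ) * Complex.I)‖ with hf
  have h1 : ‖mask B ((x + y) / N) - mask B (x / N)‖ ≤ (∑ b ∈ B, f b) / B.card := by
    rw [mask, mask, ← mul_sub, ← Finset.sum_sub_distrib, norm_mul, norm_inv, Complex.norm_natCast,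
      div_eq_inv_mul (∑ b ∈ B, f b)]
    exact mul_le_mul_of_nonneg_left (norm_sum_le _ _) (by positivity)
  refine h1.trans (average_le_of_le _ (by positivity) (fun b _ hb => ?_) fun b _ => ?_)
  · rw [Finset.mem_Ico] at hb
    have hb0 : (0 : ℝ) ≤ b := by exact_mod_cast hb.1
    have hbN : (b : ℝ) ≤ N := by exact_mod_cast hb.2.le
    have hfac : f b = ‖Complex.exp (Complex.I * ((-(2 * Real.pi * (y / N)) * b : ℝ) : ℂ)) - 1‖ := by
      have hsplit : Complex.exp (((-(2 * Real.pi * ((x + y) / N)) * b : ℝ) : ℂ) * Complex.I)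
          = Complex.exp (((-(2 * Real.pi * (x / N)) * b : ℝ) : ℂ) * Complex.I) *
            Complex.exp (Complex.I * ((-(2 * Real.pi * (y / N)) * b : ℝ) : ℂ)) := by
        rw [← Complex.exp_add]
        congr 1
        push_cast
        ring
      rw [hf]
      dsimp only
      rw [hsplit, ← mul_sub_one, norm_mul, Complex.norm_exp_ofReal_mul_I, one_mul]
    rw [hfac]
    refine (Real.norm_exp_I_mul_ofReal_sub_one_le).trans ?_
    rw [Real.norm_eq_abs, show -(2 * Real.pi * (y / N)) * (b : ℝ) = -(2 * Real.pi * y * (b / N)) by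
      ring, abs_neg, abs_mul, abs_mul, abs_of_pos (by positivity : (0 : ℝ) < 2 * Real.pi),
      abs_of_nonneg (by positivity : (0 : ℝ) ≤ b / N)]
    exact mul_le_of_le_one_right (by positivity) ((div_le_one hN').mpr hbN)
  · refine (norm_sub_le _ _).trans ?_
    rw [Complex.norm_exp_ofReal_mul_I, Complex.norm_exp_ofReal_mul_I]
    norm_num

/-! ### Lower bounds for the mask, and partial concentration -/

/-- The digits in `{0, …, N - 1}` lie within `N / 2` of the centre `N / 2`, so their terms are at
least `cos(π t) ≥ 1 - π² t² / 2 ≥ 1 - 5 t²`. -/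
lemma one_sub_sq_sub_le_norm_mask {N : ℤ} (hN : 0 < N) {B : Finset ℤ} (hB : B.Nonempty) {t : ℝ}
    (ht : |t| ≤ 1) :
    1 - 5 * t ^ 2 - 2 * (((B \ Finset.Ico 0 N).card : ℝ) / B.card) ≤ ‖mask B (t / N)‖ := by
  have hN' : (0 : ℝ) < N := by exact_mod_cast hN
  have hpi := Real.pi_pos
  have h := cos_sub_le_norm_mask hB (Finset.Ico 0 N) (t := t / N) (a := N / 2)
    (θ := Real.pi * |t|) (by nlinarith) fun b _ hb => by
      rw [Finset.mem_Ico] at hb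
      have hb0 : (0 : ℝ) ≤ b := by exact_mod_cast hb.1
      have hbN : (b : ℝ) ≤ N := by exact_mod_cast hb.2.le
      rw [show 2 * Real.pi * (t / N) * (b - N / 2) = (Real.pi * t) * ((2 * b - N) / N) by ring,
        abs_mul, abs_mul, abs_of_pos hpi]
      refine mul_le_of_le_one_right (by positivity) ?_
      rw [abs_div, abs_of_pos hN', div_le_one hN', abs_le]
      constructor <;> linarith
  have hcos := Real.one_sub_sq_div_two_le_cos (x := Real.pi * |t|)
  have hpi10 : Real.pi ^ 2 ≤ 10 := by nlinarith [Real.pi_lt_d2]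
  have : (Real.pi * |t|) ^ 2 ≤ 10 * t ^ 2 := by
    rw [mul_pow, sq_abs]
    exact mul_le_mul_of_nonneg_right hpi10 (sq_nonneg t)
  linarith

/-- The bound behind case (i) of partial concentration: centre the cosines at `(u + v) / 2`. -/
lemma cos_sub_le_norm_mask_of_digitsIn {N : ℤ} (hN : 0 < N) {B : Finset ℤ} (hB : B.Nonempty)
    {l u v x : ℝ} (hl : l ≤ 1) (huv : (v - u) / N ≤ l) (hx : |x| ≤ 1 / 2) :
    Real.cos (Real.pi * l / 2) - 2 * (((B \ digitsIn B u v).card : ℝ) / B.card)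
      ≤ ‖mask B (x / N)‖ := by
  have hN' : (0 : ℝ) < N := by exact_mod_cast hN
  have hpi := Real.pi_pos
  refine cos_sub_le_norm_mask hB _ (a := (u + v) / 2) (by nlinarith) fun b _ hb => ?_
  obtain ⟨hub, hbv⟩ := (Finset.mem_filter.mp hb).2
  rw [show 2 * Real.pi * (x / N) * (b - (u + v) / 2) = Real.pi * x * ((2 * b - (u + v)) / N) by
    ring, abs_mul, abs_mul, abs_of_pos hpi]
  have h1 : |(2 * (b : ℝ) - (u + v)) / N| ≤ l := by
    rw [abs_div, abs_of_pos hN']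
    refine le_trans ?_ huv
    gcongr
    rw [abs_le]
    constructor <;> linarith
  calc Real.pi * |x| * |(2 * (b : ℝ) - (u + v)) / N| ≤ Real.pi * (1 / 2) * l := by gcongr
    _ = Real.pi * l / 2 := by ring

/-- The bound behind case (ii) of partial concentration: centre the cosines at `N / 2`. For
`|x| ≤ 1 / 2` all digits in `{0, …, N - 1}` contribute nonnegatively, and those in `[u, v]`
contribute at least `cos(π (1 - l) / 2) = sin(π l / 2)`. -/
lemma mul_sin_sub_le_norm_mask {N : ℤ} (hN : 0 < N) {B : Finset ℤ} {l u v x : ℝ}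
    (hl : l ∈ Set.Ioo (0 : ℝ) 1) (hu : l / 2 * N ≤ u) (hv : v ≤ (1 - l / 2) * N)
    (hx : |x| ≤ 1 / 2) :
    Real.sin (Real.pi * l / 2) * (((digitsIn B u v).card : ℝ) / B.card)
      - ((B \ Finset.Ico 0 N).card : ℝ) / B.card ≤ ‖mask B (x / N)‖ := by
  have hN' : (0 : ℝ) < N := by exact_mod_cast hN
  have hpi := Real.pi_pos
  obtain ⟨hl0, hl1⟩ := hl
  have hsin : 0 ≤ Real.sin (Real.pi * l / 2) :=
    Real.sin_nonneg_of_nonneg_of_le_pi (by positivity) (by nlinarith)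
  have habs : ∀ b : ℤ, |2 * Real.pi * (x / N) * (b - N / 2)| ≤ Real.pi * |(b : ℝ) / N - 1 / 2| := by
    intro b
    rw [show 2 * Real.pi * (x / N) * (b - N / 2) = 2 * x * Real.pi * (b / N - 1 / 2) by
      field_simp, abs_mul, abs_mul, abs_of_pos hpi, abs_mul, abs_of_pos (two_pos : (0 : ℝ) < 2)]
    gcongr
    nlinarith
  have hterm : ∀ b ∈ B, (if b ∈ digitsIn B u v then Real.sin (Real.pi * l / 2) else 0)
      - (if b ∈ B \ Finset.Ico 0 N then 1 else 0)
      ≤ Real.cos (2 * Real.pi * (x / N) * (b - N / 2)) := by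
    intro b hb
    by_cases hbN : b ∈ Finset.Ico 0 N
    · have h1 : b ∉ B \ Finset.Ico 0 N := fun h => (Finset.mem_sdiff.mp h).2 hbN
      rw [if_neg h1, sub_zero]
      rw [Finset.mem_Ico] at hbN
      have hb0 : (0 : ℝ) ≤ b / N := div_nonneg (by exact_mod_cast hbN.1) hN'.le
      have hb1 : (b : ℝ) / N ≤ 1 := (div_le_one hN').mpr (by exact_mod_cast hbN.2.le)
      have hhalf : |(b : ℝ) / N - 1 / 2| ≤ 1 / 2 := by rw [abs_le]; constructor <;> linarith
      split_ifs with hD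
      · obtain ⟨hub, hbv⟩ := (Finset.mem_filter.mp hD).2
        have h2 : l / 2 ≤ b / N := (le_div_iff₀ hN').mpr (hu.trans hub)
        have h3 : (b : ℝ) / N ≤ 1 - l / 2 := (div_le_iff₀ hN').mpr (hbv.trans hv)
        have h4 : |(b : ℝ) / N - 1 / 2| ≤ 1 / 2 - l / 2 := by
          rw [abs_le]; constructor <;> linarith
        rw [← Real.cos_pi_div_two_sub, ← Real.cos_abs (2 * Real.pi * (x / N) * (b - N / 2))]
        refine Real.cos_le_cos_of_nonneg_of_le_pi (abs_nonneg _) (by nlinarith)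
          ((habs b).trans ?_)
        nlinarith
      · refine Real.cos_nonneg_of_neg_pi_div_two_le_of_le ?_ ?_ <;>
          have := abs_le.mp ((habs b).trans (mul_le_mul_of_nonneg_left hhalf hpi.le)) <;>
          linarith [this.1, this.2]
    · have h1 : b ∈ B \ Finset.Ico 0 N := Finset.mem_sdiff.mpr ⟨hb, hbN⟩
      have h2 : b ∉ digitsIn B u v := by
        intro hD
        obtain ⟨hub, hbv⟩ := (Finset.mem_filter.mp hD).2
        refine hbN (Finset.mem_Ico.mpr ⟨?_, ?_⟩)
        · have : (0 : ℝ) ≤ b := le_trans (by positivity) (hu.trans hub)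
          exact_mod_cast this
        · have : (b : ℝ) < N := by nlinarith
          exact_mod_cast this
      rw [if_pos h1, if_neg h2, zero_sub]
      exact Real.neg_one_le_cos _
  have hsub : digitsIn B u v ⊆ B := Finset.filter_subset _ _
  have hsum := Finset.sum_le_sum hterm
  rw [Finset.sum_sub_distrib, Finset.sum_ite_mem, Finset.sum_ite_mem,
    Finset.inter_eq_right.mpr hsub,
    Finset.inter_eq_right.mpr (Finset.sdiff_subset : B \ Finset.Ico 0 N ⊆ B), Finset.sum_const,
    Finset.sum_const, nsmul_eq_mul, nsmul_eq_mul, mul_one] at hsum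
  refine le_trans ?_ (average_cos_le_norm_mask B (x / N) (N / 2))
  rw [mul_div_assoc', ← sub_div]
  gcongr
  linarith

/-- Under partial concentration the masks along the subsequence are eventually bounded away from `0`
on a neighbourhood, independent of the mask, of a full period interval `[-1/2, 1/2]`. -/
lemma PartialConcentration.exists_le_norm_mask {N : ℕ → ℤ} {B : ℕ → Finset ℤ}
    (hN : ∀ n, 0 < N n) (hB : ∀ n, (B n).Nonempty) (hR : RemainderBounded N B)
    {φ : ℕ → ℕ} (hφ : StrictMono φ) (h : PartialConcentration (N ∘ φ) (B ∘ φ)) :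
    ∃ ε > 0, ∃ δ > 0, ∀ᶠ k in atTop, ∀ x : ℝ, |x| ≤ 1 / 2 + δ →
      ε ≤ ‖mask (B (φ k)) (x / N (φ k))‖ := by
  have hpi := Real.pi_pos
  have hr : Tendsto (fun k => ((B (φ k) \ Finset.Ico 0 (N (φ k))).card : ℝ) / (B (φ k)).card)
      atTop (𝓝 0) := hR.tendsto_atTop_zero.comp hφ.tendsto_atTop
  suffices hhalf : ∃ ε > 0, ∀ᶠ k in atTop, ∀ x : ℝ, |x| ≤ 1 / 2 →
      ε ≤ ‖mask (B (φ k)) (x / N (φ k))‖ by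
    obtain ⟨ε, hε, hk⟩ := hhalf
    refine ⟨ε / 2, half_pos hε, ε / 4 / (2 * Real.pi), by positivity, ?_⟩
    filter_upwards [hk, hr.eventually_lt_const (show 0 < ε / 8 by positivity)] with k h1 h2 x hx
    -- `x` is moved by at most `δ` to a point `z` of `[-1/2, 1/2]`
    obtain ⟨z, hz, hxz⟩ : ∃ z : ℝ, |z| ≤ 1 / 2 ∧ |x - z| ≤ ε / 4 / (2 * Real.pi) := by
      have hδ : 0 < ε / 4 / (2 * Real.pi) := by positivity
      rw [abs_le] at hx
      refine ⟨max (-(1 / 2)) (min x (1 / 2)), ?_, ?_⟩ <;> rw [abs_le] <;>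
        constructor <;> grind
    have h3 := norm_mask_add_sub_mask_le (hN (φ k)) (B (φ k)) z (x - z)
    rw [add_sub_cancel] at h3
    have h4 : 2 * Real.pi * |x - z| ≤ ε / 4 := by
      rw [le_div_iff₀ (by positivity)] at hxz
      linarith
    have h5 := norm_sub_norm_le (mask (B (φ k)) (z / N (φ k))) (mask (B (φ k)) (x / N (φ k)))
    rw [norm_sub_rev] at h5
    linarith [h1 z hz]
  obtain ⟨l, hl, ⟨u, v, huv, hsum⟩ | ⟨c, hc, u, v, huv⟩⟩ := h
  · have hcos : 0 < Real.cos (Real.pi * l / 2) :=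
      Real.cos_pos_of_mem_Ioo ⟨by nlinarith [hl.1], by nlinarith [hl.2]⟩
    refine ⟨Real.cos (Real.pi * l / 2) / 2, half_pos hcos, ?_⟩
    filter_upwards [hsum.tendsto_atTop_zero.eventually_lt_const
      (show 0 < Real.cos (Real.pi * l / 2) / 4 by positivity)] with k hk x hx
    have := cos_sub_le_norm_mask_of_digitsIn (hN (φ k)) (hB (φ k)) hl.2.le
      (huv k).2.2.2.le hx
    dsimp only [Function.comp_apply] at this hk
    linarith
  · have hsin : 0 < Real.sin (Real.pi * l / 2) :=
      Real.sin_pos_of_pos_of_lt_pi (by have := hl.1; positivity) (by nlinarith [hl.2])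
    have hc0 : 0 < c := hc.1
    refine ⟨Real.sin (Real.pi * l / 2) * c / 2, by positivity, ?_⟩
    filter_upwards [hr.eventually_lt_const
      (show 0 < Real.sin (Real.pi * l / 2) * c / 2 by positivity)] with k hk x hx
    have h1 := mul_sin_sub_le_norm_mask (B := B (φ k)) (hN (φ k)) hl (huv k).1.1 (huv k).2.1.2 hx
    have h2 := mul_le_mul_of_nonneg_left (huv k).2.2 hsin.le
    dsimp only [Function.comp_apply] at h1 h2
    linarith

/-! ### Fourier transforms of the partial convolutions -/

/-- The product `N 0 * ⋯ * N (n - 1)` of the first `n` moduli. -/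
def modulus (N : ℕ → ℤ) (n : ℕ) : ℤ := ∏ i ∈ Finset.range n, N i

/-- The function `F_n(ξ) = ∏_{i < n} m_{B_i}(ξ / (N_0 ⋯ N_i))`, which is the Fourier transform of
the `n`-th partial convolution (`charFun_partialConvolution`). -/
noncomputable def maskProd (N : ℕ → ℤ) (B : ℕ → Finset ℤ) (n : ℕ) (ξ : ℝ) : ℂ :=
  ∏ i ∈ Finset.range n, mask (B i) (ξ / modulus N (i + 1))

lemma modulus_succ (N : ℕ → ℤ) (n : ℕ) : modulus N (n + 1) = modulus N n * N n :=
  Finset.prod_range_succ _ _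

lemma modulus_pos {N : ℕ → ℤ} (hN : ∀ n, 0 < N n) (n : ℕ) : 0 < modulus N n :=
  Finset.prod_pos fun i _ => hN i

lemma two_pow_mul_modulus_le {N : ℕ → ℤ} (hN : ∀ n, 2 ≤ N n) (m k : ℕ) :
    2 ^ k * modulus N m ≤ modulus N (m + k) := by
  induction k with
  | zero => simp
  | succ k ih =>
    have hpos := modulus_pos (fun n => (by have := hN n; omega : 0 < N n)) (m + k)
    rw [← add_assoc, modulus_succ]
    have := mul_le_mul_of_nonneg_left (hN (m + k)) hpos.le
    rw [pow_succ]
    linarith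

lemma two_pow_le_modulus {N : ℕ → ℤ} (hN : ∀ n, 2 ≤ N n) (n : ℕ) : 2 ^ n ≤ modulus N n := by
  have := two_pow_mul_modulus_le hN 0 n
  simpa [modulus] using this

lemma modulus_dvd (N : ℕ → ℤ) {m n : ℕ} (h : m ≤ n) : modulus N m ∣ modulus N n :=
  Finset.prod_dvd_prod_of_subset _ _ _ (Finset.range_subset_range.mpr h)

lemma maskProd_succ (N : ℕ → ℤ) (B : ℕ → Finset ℤ) (n : ℕ) (ξ : ℝ) :
    maskProd N B (n + 1) ξ = maskProd N B n ξ * mask (B n) (ξ / modulus N (n + 1)) :=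
  Finset.prod_range_succ _ _

lemma norm_maskProd_le_one (N : ℕ → ℤ) (B : ℕ → Finset ℤ) (n : ℕ) (ξ : ℝ) :
    ‖maskProd N B n ξ‖ ≤ 1 := by
  rw [maskProd, norm_prod]
  exact Finset.prod_le_one (fun _ _ => norm_nonneg _) fun _ _ => norm_mask_le_one _ _

lemma maskProd_zero_right (N : ℕ → ℤ) {B : ℕ → Finset ℤ} (hB : ∀ n, (B n).Nonempty) (n : ℕ) :
    maskProd N B n 0 = 1 :=
  Finset.prod_eq_one fun i _ => by rw [zero_div, mask_zero (hB i)]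

lemma continuous_maskProd (N : ℕ → ℤ) (B : ℕ → Finset ℤ) (n : ℕ) :
    Continuous (maskProd N B n) := by
  unfold maskProd
  exact continuous_finsetProd _ fun i _ => (continuous_mask (B i)).comp (continuous_id.div_const _)

lemma maskProd_add_modulus_mul {N : ℕ → ℤ} (hN : ∀ n, 0 < N n) (B : ℕ → Finset ℤ) (n : ℕ) (ξ : ℝ)
    (k : ℤ) : maskProd N B n (ξ + modulus N n * k) = maskProd N B n ξ := by
  refine Finset.prod_congr rfl fun i hi => ?_
  obtain ⟨c, hc⟩ := modulus_dvd N (Nat.succ_le_of_lt (Finset.mem_range.mp hi))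
  have h0 : ((modulus N (i + 1) : ℤ) : ℝ) ≠ 0 := by exact_mod_cast (modulus_pos hN (i + 1)).ne'
  have h1 : (modulus N n : ℝ) = modulus N (i + 1) * c := by exact_mod_cast hc
  rw [h1, show (ξ + modulus N (i + 1) * c * k) / (modulus N (i + 1) : ℝ)
    = ξ / modulus N (i + 1) + ((c * k : ℤ) : ℝ) by push_cast; field_simp, mask_add_intCast]

lemma maskProd_eq_mul_prod_Ico (N : ℕ → ℤ) (B : ℕ → Finset ℤ) {m n : ℕ} (h : m ≤ n) (ξ : ℝ) :
    maskProd N B n ξ =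
      maskProd N B m ξ * ∏ i ∈ Finset.Ico m n, mask (B i) (ξ / modulus N (i + 1)) :=
  (Finset.prod_range_mul_prod_Ico _ h).symm

lemma norm_maskProd_succ_sub_le {N : ℕ → ℤ} (hN : ∀ n, 2 ≤ N n) {B : ℕ → Finset ℤ}
    (hB : ∀ n, (B n).Nonempty) (n : ℕ) (ξ : ℝ) :
    ‖maskProd N B (n + 1) ξ - maskProd N B n ξ‖ ≤ 2 * Real.pi * |ξ| * (1 / 2) ^ n +
      2 * (((B n \ Finset.Ico 0 (N n)).card : ℝ) / (B n).card) := by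
  have hN0 : 0 < N n := by have := hN n; omega
  have hP : (2 : ℝ) ^ n ≤ modulus N n := by exact_mod_cast two_pow_le_modulus hN n
  have hP0 : (0 : ℝ) < modulus N n := lt_of_lt_of_le (by positivity) hP
  have h := norm_mask_add_sub_mask_le hN0 (B n) 0 (ξ / modulus N n)
  rw [zero_add, zero_div, mask_zero (hB n), div_div] at h
  rw [maskProd_succ, ← mul_sub_one, norm_mul, modulus_succ, Int.cast_mul]
  refine (mul_le_of_le_one_left (norm_nonneg _) (norm_maskProd_le_one N B n ξ)).trans
    (h.trans ?_)
  have : |ξ / modulus N n| ≤ |ξ| * (1 / 2) ^ n := by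
    rw [abs_div, abs_of_pos hP0, div_pow, one_pow, mul_one_div]
    gcongr
  have := mul_le_mul_of_nonneg_left this (by positivity : 0 ≤ 2 * Real.pi)
  linarith

lemma exists_tendsto_maskProd {N : ℕ → ℤ} (hN : ∀ n, 2 ≤ N n) {B : ℕ → Finset ℤ}
    (hB : ∀ n, (B n).Nonempty) (hR : RemainderBounded N B) :
    ∃ f : ℝ → ℂ, ContinuousAt f 0 ∧ ∀ ξ, Tendsto (fun n => maskProd N B n ξ) atTop (𝓝 (f ξ)) := by
  have hsum : ∀ ξ : ℝ, Summable fun n => 2 * Real.pi * |ξ| * (1 / 2 : ℝ) ^ n +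
      2 * (((B n \ Finset.Ico 0 (N n)).card : ℝ) / (B n).card) := fun ξ =>
    (summable_geometric_two.mul_left _).add (hR.mul_left 2)
  refine ⟨fun ξ => (∑' n, (maskProd N B (n + 1) ξ - maskProd N B n ξ)) + 1, ?_, fun ξ => ?_⟩
  · refine ContinuousAt.add ?_ continuousAt_const
    refine (continuousOn_tsum (s := Set.Icc (-1 : ℝ) 1) (fun n => ?_) (hsum 1)
      fun n ξ hξ => ?_).continuousAt (Icc_mem_nhds (by norm_num) (by norm_num))
    · exact ((continuous_maskProd N B _).sub (continuous_maskProd N B _)).continuousOn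
    · refine (norm_maskProd_succ_sub_le hN hB n ξ).trans ?_
      have : |ξ| ≤ |(1 : ℝ)| := by rw [abs_one]; exact abs_le.mpr hξ
      gcongr
  · have h := (Summable.of_norm_bounded (hsum ξ)
      (norm_maskProd_succ_sub_le hN hB · ξ)).hasSum.tendsto_sum_nat
    refine (h.add_const 1).congr fun n => ?_
    rw [Finset.sum_range_sub fun n => maskProd N B n ξ]
    simp [maskProd]

/-- The tails of the infinite product do not vanish near `0`, uniformly in the starting point. With
`|ξ| ≤ 3/10 P_m`, the factor of index `m + k` is at least `1 - 5 (3/10)² 4^{-k} - 2 r_{m+k}`, where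
`r` is the proportion of remainder digits; and `∏ (1 - a_k) ≥ 1 - ∑ a_k`, in which the geometric
part sums to `3/5`. -/
lemma quarter_le_norm_prod_Ico {N : ℕ → ℤ} (hN : ∀ n, 2 ≤ N n) {B : ℕ → Finset ℤ}
    (hB : ∀ n, (B n).Nonempty) (hR : RemainderBounded N B) :
    ∀ᶠ m in atTop, ∀ ξ : ℝ, |ξ| ≤ 3 / 10 * modulus N m → ∀ n,
      1 / 4 ≤ ‖∏ i ∈ Finset.Ico m n, mask (B i) (ξ / modulus N (i + 1))‖ := by
  set r : ℕ → ℝ := fun n => ((B n \ Finset.Ico 0 (N n)).card : ℝ) / (B n).card with hr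
  have htail : Tendsto (fun m => ∑' k, r (k + m)) atTop (𝓝 0) := tendsto_sum_nat_add r
  filter_upwards [htail.eventually_lt_const (by norm_num : (0 : ℝ) < 1 / 20)] with m hm ξ hξ n
  have hP0 : ∀ n, (0 : ℝ) < modulus N n := fun n => by
    exact_mod_cast modulus_pos (fun n => (by have := hN n; omega : 0 < N n)) n
  -- the `k`-th factor of the product is at least `1 - a k`
  set a : ℕ → ℝ := fun k => 9 / 20 * (1 / 4) ^ k + 2 * r (k + m) with ha
  have ha0 : ∀ k, 0 ≤ a k := fun k => by positivity
  have hrm : Summable fun k => r (k + m) := (summable_nat_add_iff m).mpr hR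
  have hgeo : Summable fun k : ℕ => (1 / 4 : ℝ) ^ k :=
    summable_geometric_of_lt_one (by norm_num) (by norm_num)
  have hasum : Summable a := (hgeo.mul_left _).add (hrm.mul_left 2)
  have hfac : ∀ k, 1 - a k ≤ ‖mask (B (m + k)) (ξ / modulus N (m + k + 1))‖ := by
    intro k
    have h2 : (2 : ℝ) ^ k * modulus N m ≤ modulus N (m + k) := by
      exact_mod_cast two_pow_mul_modulus_le hN m k
    have ht : |ξ / modulus N (m + k)| ≤ 3 / 10 * (1 / 2) ^ k := by
      rw [abs_div, abs_of_pos (hP0 _), div_le_iff₀ (hP0 _)]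
      calc |ξ| ≤ 3 / 10 * modulus N m := hξ
        _ = 3 / 10 * (1 / 2) ^ k * (2 ^ k * modulus N m) := by
          rw [one_div, inv_pow]; field_simp
        _ ≤ _ := by gcongr
    have ht1 : |ξ / modulus N (m + k)| ≤ 1 := by
      refine ht.trans ?_
      have : (1 / 2 : ℝ) ^ k ≤ 1 := pow_le_one₀ (by norm_num) (by norm_num)
      linarith
    have h3 := one_sub_sq_sub_le_norm_mask (by have := hN (m + k); omega : 0 < N (m + k))
      (hB (m + k)) ht1
    rw [div_div, ← Int.cast_mul, ← modulus_succ] at h3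
    refine le_trans ?_ h3
    have h4 : (ξ / modulus N (m + k)) ^ 2 ≤ 9 / 100 * (1 / 4) ^ k := by
      rw [← sq_abs]
      refine (pow_le_pow_left₀ (abs_nonneg _) ht 2).trans (le_of_eq ?_)
      rw [mul_pow, ← pow_mul, mul_comm k 2, pow_mul]
      norm_num
    rw [ha, hr]
    dsimp only
    rw [add_comm k m]
    linarith
  have hfin : ∑ k ∈ Finset.range (n - m), a k ≤ 3 / 4 := by
    refine (hasum.sum_le_tsum _ fun k _ => ha0 k).trans ?_
    rw [ha, (hgeo.mul_left _).tsum_add (hrm.mul_left 2), tsum_mul_left, tsum_mul_left,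
      tsum_geometric_of_lt_one (by norm_num) (by norm_num)]
    linarith
  have ha1 : ∀ k ∈ Finset.range (n - m), a k ≤ 1 := fun k hk =>
    ((Finset.single_le_sum (fun i _ => ha0 i) hk).trans hfin).trans (by norm_num)
  rw [norm_prod, Finset.prod_Ico_eq_prod_range]
  have hprod : ∀ s : Finset ℕ, (∀ k ∈ s, a k ≤ 1) → 1 - ∑ k ∈ s, a k ≤ ∏ k ∈ s, (1 - a k) := by
    intro s hs
    induction s using Finset.cons_induction with
    | empty => simp
    | cons i s hi ih =>
      rw [Finset.sum_cons, Finset.prod_cons]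
      have h1 := ih fun k hk => hs k (Finset.mem_cons_of_mem hk)
      have h2 := hs i (Finset.mem_cons_self i s)
      have h3 : 0 ≤ ∑ k ∈ s, a k := Finset.sum_nonneg fun k _ => ha0 k
      nlinarith [ha0 i]
  calc (1 : ℝ) / 4 ≤ 1 - ∑ k ∈ Finset.range (n - m), a k := by linarith
    _ ≤ ∏ k ∈ Finset.range (n - m), (1 - a k) := hprod _ ha1
    _ ≤ _ := Finset.prod_le_prod (fun k hk => by linarith [ha1 k hk]) fun k _ => hfac k

/-! ### Existence of the infinite convolution -/

lemma isProbabilityMeasure_uniformDiscrete {A : Finset ℝ} (hA : A.Nonempty) :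
    IsProbabilityMeasure (uniformDiscrete A) := by
  refine ⟨?_⟩
  simp only [uniformDiscrete, Measure.smul_apply, Measure.coe_finsetSum, Finset.sum_apply,
    measure_univ, Finset.sum_const, nsmul_eq_mul, mul_one, smul_eq_mul]
  exact ENNReal.inv_mul_cancel (by exact_mod_cast hA.card_pos.ne') (ENNReal.natCast_ne_top _)

lemma scaledDigits_nonempty (N : ℕ → ℤ) {B : ℕ → Finset ℤ} (hB : ∀ n, (B n).Nonempty) (n : ℕ) :
    (scaledDigits N B n).Nonempty :=
  (hB n).image _

lemma isProbabilityMeasure_partialConvolution (N : ℕ → ℤ) {B : ℕ → Finset ℤ}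
    (hB : ∀ n, (B n).Nonempty) (n : ℕ) : IsProbabilityMeasure (partialConvolution N B n) := by
  induction n with
  | zero => exact Measure.dirac.isProbabilityMeasure
  | succ n ih =>
    have := isProbabilityMeasure_uniformDiscrete (scaledDigits_nonempty N hB n)
    rw [partialConvolution]
    infer_instance

lemma charFun_uniformDiscrete_scaledDigits {N : ℕ → ℤ} (hN : ∀ n, 0 < N n) (B : ℕ → Finset ℤ)
    (n : ℕ) (ξ : ℝ) :
    charFun (uniformDiscrete (scaledDigits N B n)) (-(2 * Real.pi * ξ)) =
      mask (B n) (ξ / modulus N (n + 1)) := by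
  have hP : (∏ i ∈ Finset.range (n + 1), (N i : ℝ)) = modulus N (n + 1) := by
    rw [modulus]; push_cast; rfl
  have hP0 : (modulus N (n + 1) : ℝ) ≠ 0 := by exact_mod_cast (modulus_pos hN (n + 1)).ne'
  have hinj : Function.Injective fun b : ℤ => (b : ℝ) / modulus N (n + 1) := fun a b hab => by
    exact_mod_cast (div_left_inj' hP0).mp hab
  rw [charFun_apply_real, uniformDiscrete, integral_smul_measure,
    integral_finsetSum_measure fun a _ => integrable_dirac (by simp), scaledDigits, hP,
    Finset.card_image_of_injective _ hinj, Finset.sum_image hinj.injOn, mask]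
  simp only [integral_dirac, ENNReal.toReal_inv, ENNReal.toReal_natCast, Complex.real_smul]
  push_cast
  congr 1
  refine Finset.sum_congr rfl fun b _ => ?_
  congr 1
  ring

lemma charFun_partialConvolution {N : ℕ → ℤ} (hN : ∀ n, 0 < N n) {B : ℕ → Finset ℤ}
    (hB : ∀ n, (B n).Nonempty) (n : ℕ) (ξ : ℝ) :
    charFun (partialConvolution N B n) (-(2 * Real.pi * ξ)) = maskProd N B n ξ := by
  induction n with
  | zero => simp [partialConvolution, maskProd, charFun_dirac]
  | succ n ih =>
    have := isProbabilityMeasure_uniformDiscrete (scaledDigits_nonempty N hB n)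
    have := isProbabilityMeasure_partialConvolution N hB n
    rw [partialConvolution, charFun_conv, ih, charFun_uniformDiscrete_scaledDigits hN,
      maskProd_succ]

/-- **Lévy's continuity theorem** without a given limit measure: convergence of the characteristic
functions to a function continuous at `0` gives tightness, and a limit point exists by Prokhorov's
theorem. -/
lemma exists_tendsto_probabilityMeasure_of_tendsto_charFun (μ : ℕ → ProbabilityMeasure ℝ)
    {f : ℝ → ℂ} (hf : ContinuousAt f 0)
    (h : ∀ t, Tendsto (fun n => charFun (μ n : Measure ℝ) t) atTop (𝓝 (f t))) :
    ∃ ν : ProbabilityMeasure ℝ, Tendsto μ atTop (𝓝 ν) := by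
  have htight := isTightMeasureSet_of_tendsto_charFun (μ := fun n => (μ n : Measure ℝ)) hf h
  have hcomp := isCompact_closure_of_isTightMeasureSet (S := Set.range μ) (by
    convert htight using 1
    ext ν
    simp)
  obtain ⟨ν, -, ψ, hψ, hlim⟩ := hcomp.isSeqCompact fun n => subset_closure (Set.mem_range_self n)
  refine ⟨ν, ProbabilityMeasure.tendsto_iff_tendsto_charFun.mpr fun t => ?_⟩
  have h1 := ProbabilityMeasure.tendsto_iff_tendsto_charFun.mp hlim t
  rw [tendsto_nhds_unique h1 ((h t).comp hψ.tendsto_atTop)]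
  exact h t

lemma exists_isInfiniteConvolution {N : ℕ → ℤ} (hN : ∀ n, 2 ≤ N n) {B : ℕ → Finset ℤ}
    (hB : ∀ n, (B n).Nonempty) (hR : RemainderBounded N B) :
    ∃ μ : ProbabilityMeasure ℝ, IsInfiniteConvolution N B μ ∧ ∀ ξ : ℝ,
      Tendsto (fun n => maskProd N B n ξ) atTop
        (𝓝 (charFun (μ : Measure ℝ) (-(2 * Real.pi * ξ)))) := by
  have hN0 : ∀ n, 0 < N n := fun n => by have := hN n; omega
  have hpi := Real.pi_pos.ne'
  have hprob := isProbabilityMeasure_partialConvolution N hB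
  obtain ⟨f, hf, hlim⟩ := exists_tendsto_maskProd hN hB hR
  have hcf : ∀ n t, charFun (partialConvolution N B n) t =
      maskProd N B n (-t / (2 * Real.pi)) := fun n t => by
    rw [← charFun_partialConvolution hN0 hB]
    congr 1
    field_simp
  obtain ⟨μ, hμ⟩ := exists_tendsto_probabilityMeasure_of_tendsto_charFun
    (fun n => ⟨partialConvolution N B n, hprob n⟩) (f := fun t => f (-t / (2 * Real.pi)))
    (ContinuousAt.comp (by simpa using hf) (by fun_prop))
    fun t => (hlim _).congr fun n => (hcf n t).symm
  refine ⟨μ, ⟨hprob, hμ⟩, fun ξ => ?_⟩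
  exact (ProbabilityMeasure.tendsto_iff_tendsto_charFun.mp hμ _).congr fun n =>
    charFun_partialConvolution hN0 hB n ξ

/-! ### Spectra of the partial convolutions -/

/-- `Λ` is a spectrum of the `n`-th partial convolution, expressed by the Parseval identity for all
exponentials. Orthogonality is the case where `-ξ` is an element of `Λ`. -/
def IsLevelSpectrum (N : ℕ → ℤ) (B : ℕ → Finset ℤ) (n : ℕ) (Λ : Finset ℤ) : Prop :=
  ∀ ξ : ℝ, ∑ m ∈ Λ, ‖maskProd N B n (ξ + m)‖ ^ 2 = 1

lemma isLevelSpectrum_zero (N : ℕ → ℤ) (B : ℕ → Finset ℤ) : IsLevelSpectrum N B 0 {0} := by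
  intro ξ
  simp [maskProd]

/-- If two of the frequencies `g i` were equal, then at `ξ = -g i` the sum would be at least `2`. -/
lemma injOn_of_sum_norm_maskProd_sq {N : ℕ → ℤ} {B : ℕ → Finset ℤ} (hB : ∀ n, (B n).Nonempty)
    {n : ℕ} {ι : Type*} {s : Finset ι} {g : ι → ℤ}
    (h : ∀ ξ : ℝ, ∑ i ∈ s, ‖maskProd N B n (ξ + g i)‖ ^ 2 = 1) : Set.InjOn g s := by
  classical
  intro i hi j hj hij
  by_contra hne
  have h1 := Finset.sum_le_sum_of_subset_of_nonneg (s := {i, j}) (t := s)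
    (f := fun k => ‖maskProd N B n (-g i + g k)‖ ^ 2)
    (by intro k hk; rcases Finset.mem_insert.mp hk with rfl | hk
        · exact hi
        · rw [Finset.mem_singleton.mp hk]; exact hj)
    fun k _ _ => sq_nonneg _
  rw [h, Finset.sum_pair hne, ← hij, neg_add_cancel, maskProd_zero_right N hB] at h1
  norm_num at h1

lemma IsLevelSpectrum.image {N : ℕ → ℤ} {B : ℕ → Finset ℤ} (hB : ∀ n, (B n).Nonempty)
    {n : ℕ} {ι : Type*} {s : Finset ι} {g : ι → ℤ}
    (h : ∀ ξ : ℝ, ∑ i ∈ s, ‖maskProd N B n (ξ + g i)‖ ^ 2 = 1) :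
    IsLevelSpectrum N B n (s.image g) := by
  intro ξ
  rw [Finset.sum_image (injOn_of_sum_norm_maskProd_sq hB h), h]

lemma IsLevelSpectrum.exists_succ {N : ℕ → ℤ} (hN : ∀ n, 0 < N n) {B : ℕ → Finset ℤ}
    (hadm : ∀ n, IsAdmissiblePair (N n) (B n)) (hB : ∀ n, (B n).Nonempty) {n : ℕ} {Λ : Finset ℤ}
    (h : IsLevelSpectrum N B n Λ) : ∃ Λ', Λ ⊆ Λ' ∧ IsLevelSpectrum N B (n + 1) Λ' := by
  obtain ⟨L, hL0, hL⟩ := (hadm n).exists_sum_norm_mask_sq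
  refine ⟨(Λ ×ˢ L).image fun p => p.1 + modulus N n * p.2, fun m hm => ?_,
    IsLevelSpectrum.image hB fun ξ => ?_⟩
  · exact Finset.mem_image.mpr ⟨(m, 0), Finset.mk_mem_product hm hL0, by simp⟩
  · have hP : (modulus N n : ℝ) ≠ 0 := by exact_mod_cast (modulus_pos hN n).ne'
    have hNn : (N n : ℝ) ≠ 0 := by exact_mod_cast (hN n).ne'
    rw [Finset.sum_product, ← h ξ]
    refine Finset.sum_congr rfl fun m _ => ?_
    rw [← mul_one (‖maskProd N B n (ξ + m)‖ ^ 2), ← hL ((ξ + m) / modulus N (n + 1)),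
      Finset.mul_sum]
    refine Finset.sum_congr rfl fun ℓ _ => ?_
    push_cast
    rw [← add_assoc, maskProd_succ, maskProd_add_modulus_mul hN, norm_mul, mul_pow, modulus_succ]
    congr 4
    push_cast
    field_simp

lemma IsLevelSpectrum.exists_of_le {N : ℕ → ℤ} (hN : ∀ n, 0 < N n) {B : ℕ → Finset ℤ}
    (hadm : ∀ n, IsAdmissiblePair (N n) (B n)) (hB : ∀ n, (B n).Nonempty) {n m : ℕ} (hnm : n ≤ m)
    {Λ : Finset ℤ} (h : IsLevelSpectrum N B n Λ) :
    ∃ Λ', Λ ⊆ Λ' ∧ IsLevelSpectrum N B m Λ' := by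
  induction m, hnm using Nat.le_induction with
  | base => exact ⟨Λ, Finset.Subset.refl _, h⟩
  | succ m _ ih =>
    obtain ⟨Λ', hsub, h'⟩ := ih
    obtain ⟨Λ'', hsub', h''⟩ := h'.exists_succ hN hadm hB
    exact ⟨Λ'', hsub.trans hsub', h''⟩

/-- A spectrum may be replaced by the residues of least absolute value, since `F_n` is periodic
modulo `N_0 ⋯ N_{n-1}`; frequencies that are small already stay in place. -/
lemma IsLevelSpectrum.exists_reduced {N : ℕ → ℤ} (hN : ∀ n, 0 < N n) {B : ℕ → Finset ℤ}
    (hB : ∀ n, (B n).Nonempty) {n : ℕ} {Λ Λ' : Finset ℤ} (hsub : Λ ⊆ Λ')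
    (hsmall : ∀ m ∈ Λ, 2 * |m| < modulus N n) (h : IsLevelSpectrum N B n Λ') :
    ∃ Λ'', Λ ⊆ Λ'' ∧ (∀ m ∈ Λ'', 2 * |m| ≤ modulus N n) ∧ IsLevelSpectrum N B n Λ'' := by
  have hP := modulus_pos hN n
  -- `m - P * ((2 * m + P) / (2 * P))` is the residue of `m` modulo `P` nearest to `0`
  set q : ℤ → ℤ := fun m => (2 * m + modulus N n) / (2 * modulus N n) with hq
  have hq1 : ∀ m, 2 * modulus N n * q m ≤ 2 * m + modulus N n := fun m =>
    Int.mul_ediv_self_le (by omega)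
  have hq2 : ∀ m, 2 * m + modulus N n < 2 * modulus N n * q m + 2 * modulus N n := fun m =>
    Int.lt_mul_ediv_self_add (by omega)
  refine ⟨Λ'.image fun m => m + modulus N n * -q m, fun m hm => ?_, fun m hm => ?_,
    IsLevelSpectrum.image hB fun ξ => ?_⟩
  · refine Finset.mem_image.mpr ⟨m, hsub hm, ?_⟩
    have := abs_lt.mp (show |2 * m| < modulus N n by rw [abs_mul]; exact hsmall m hm)
    have h0 : q m = 0 := Int.ediv_eq_zero_of_lt (by linarith) (by linarith)
    simp [h0]
  · obtain ⟨k, -, rfl⟩ := Finset.mem_image.mp hm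
    rw [show 2 * |k + modulus N n * -q k| = |2 * (k + modulus N n * -q k)| by
      rw [abs_mul]; rfl, abs_le]
    constructor <;> nlinarith [hq1 k, hq2 k]
  · rw [← h ξ]
    refine Finset.sum_congr rfl fun m _ => ?_
    rw [Int.cast_add, Int.cast_mul, ← add_assoc, maskProd_add_modulus_mul hN]

/-! ### The spectral criterion -/

/-- If Bessel's inequality is an equality for `x`, then `x` lies in the closed span of the
orthonormal family, hence is orthogonal to everything orthogonal to the family. -/
lemma inner_eq_zero_of_hasSum_norm_sq {H ι : Type*} [NormedAddCommGroup H] [InnerProductSpace ℂ H]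
    {v : ι → H} (hv : Orthonormal ℂ v) {x g : H}
    (hx : HasSum (fun i => ‖inner ℂ x (v i)‖ ^ 2) (‖x‖ ^ 2)) (hg : ∀ i, inner ℂ (v i) g = 0) :
    inner ℂ x g = 0 := by
  have hnorm : ∀ s : Finset ι, ‖x - ∑ i ∈ s, inner ℂ (v i) x • v i‖ ^ 2 =
      ‖x‖ ^ 2 - ∑ i ∈ s, ‖inner ℂ x (v i)‖ ^ 2 := by
    intro s
    have h1 : inner ℂ (∑ i ∈ s, inner ℂ (v i) x • v i) x =
        ((∑ i ∈ s, ‖inner ℂ x (v i)‖ ^ 2 : ℝ) : ℂ) := by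
      rw [sum_inner]
      push_cast
      refine Finset.sum_congr rfl fun i _ => ?_
      rw [inner_smul_left, norm_inner_symm, Complex.conj_mul']
    have h2 : ‖∑ i ∈ s, inner ℂ (v i) x • v i‖ ^ 2 = ∑ i ∈ s, ‖inner ℂ x (v i)‖ ^ 2 := by
      have h3 := hv.inner_sum (fun i => inner ℂ (v i) x) (fun i => inner ℂ (v i) x) s
      rw [inner_self_eq_norm_sq_to_K] at h3
      apply Complex.ofReal_injective
      push_cast
      refine h3.trans (Finset.sum_congr rfl fun i _ => ?_)
      rw [norm_inner_symm, Complex.conj_mul']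
    rw [@norm_sub_sq ℂ, h2, inner_re_symm, h1]
    simp only [RCLike.re_to_complex, Complex.ofReal_re]
    ring
  have hlim : Tendsto (fun s : Finset ι => ‖x - ∑ i ∈ s, inner ℂ (v i) x • v i‖ ^ 2) atTop
      (𝓝 0) := by
    simp_rw [hnorm]
    rw [← sub_self (‖x‖ ^ 2)]
    exact Tendsto.const_sub _ hx
  have hlim' : Tendsto (fun s : Finset ι => ‖x - ∑ i ∈ s, inner ℂ (v i) x • v i‖ * ‖g‖) atTop
      (𝓝 0) := by
    have h := (hlim.sqrt.mul_const ‖g‖)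
    simpa [Real.sqrt_sq] using h
  have hle : ∀ s : Finset ι, ‖inner ℂ x g‖ ≤ ‖x - ∑ i ∈ s, inner ℂ (v i) x • v i‖ * ‖g‖ := by
    intro s
    have : inner ℂ x g = inner ℂ (x - ∑ i ∈ s, inner ℂ (v i) x • v i) g := by
      rw [inner_sub_left, sum_inner]
      simp [inner_smul_left, hg]
    rw [this]
    exact norm_inner_le_norm _ _
  exact norm_le_zero_iff.mp (ge_of_tendsto' hlim' hle)

/-- Uniqueness of the Fourier transform for a real integrable density: the measures with densities
the positive and the negative part have the same characteristic function. -/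
lemma ae_eq_zero_of_integral_exp_mul_ofReal {μ : Measure ℝ} [IsFiniteMeasure μ] {g : ℝ → ℝ}
    (hg : Integrable g μ) (h : ∀ t : ℝ, ∫ x, Complex.exp (t * x * Complex.I) * g x ∂μ = 0) :
    g =ᵐ[μ] 0 := by
  have hexp : ∀ t : ℝ, Continuous fun x : ℝ => Complex.exp (t * x * Complex.I) := fun t => by
    fun_prop
  have hnorm : ∀ t x : ℝ, ‖Complex.exp (t * x * Complex.I)‖ ≤ 1 := fun t x => by
    rw [← Complex.ofReal_mul, Complex.norm_exp_ofReal_mul_I]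
  have hint : ∀ (t : ℝ) {k : ℝ → ℝ}, Integrable k μ →
      Integrable (fun x : ℝ => Complex.exp (t * x * Complex.I) * k x) μ := fun t k hk =>
    hk.ofReal.bdd_mul (hexp t).aestronglyMeasurable (ae_of_all _ (hnorm t))
  have hcf : ∀ {k : ℝ → ℝ}, Integrable k μ → ∀ t : ℝ,
      charFun (μ.withDensity fun x => ENNReal.ofReal (k x)) t =
        ∫ x, Complex.exp (t * x * Complex.I) * (max (k x) 0 : ℝ) ∂μ := by
    intro k hk t
    rw [charFun_apply_real, integral_withDensity_eq_integral_toReal_smul₀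
      hk.aemeasurable.ennreal_ofReal (ae_of_all _ fun x => ENNReal.ofReal_lt_top)]
    refine integral_congr_ae (ae_of_all _ fun x => ?_)
    dsimp only
    rw [ENNReal.toReal_ofReal', Complex.real_smul, mul_comm]
  have hfin : ∀ {k : ℝ → ℝ}, Integrable k μ → ∫⁻ x, ENNReal.ofReal (k x) ∂μ ≠ ∞ := fun hk =>
    hk.lintegral_lt_top.ne
  have hfin1 := isFiniteMeasure_withDensity (hfin hg)
  have hfin2 := isFiniteMeasure_withDensity (hfin hg.neg)
  have heq : (μ.withDensity fun x => ENNReal.ofReal (g x)) =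
      μ.withDensity fun x => ENNReal.ofReal ((-g) x) := by
    refine Measure.ext_of_charFun (funext fun t => ?_)
    rw [hcf hg, hcf hg.neg, ← sub_eq_zero, ← integral_sub (hint t hg.pos_part)
      (hint t hg.neg.pos_part), ← h t]
    refine integral_congr_ae (ae_of_all _ fun x => ?_)
    dsimp only
    rw [← mul_sub, ← Complex.ofReal_sub]
    congr 2
    rw [Pi.neg_apply]
    rcases le_total (g x) 0 with hx | hx
    · rw [max_eq_right hx, max_eq_left (by linarith)]; ring
    · rw [max_eq_left hx, max_eq_right (by linarith)]; ring
  have hae := (withDensity_eq_iff hg.aemeasurable.ennreal_ofReal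
    hg.neg.aemeasurable.ennreal_ofReal (hfin hg)).mp heq
  filter_upwards [hae] with x hx
  rw [Pi.neg_apply] at hx
  change g x = 0
  rcases le_total (g x) 0 with h0 | h0
  · rw [ENNReal.ofReal_of_nonpos h0, eq_comm, ENNReal.ofReal_eq_zero] at hx
    exact le_antisymm h0 (by linarith)
  · rw [ENNReal.ofReal_of_nonpos (by linarith : -g x ≤ 0), ENNReal.ofReal_eq_zero] at hx
    exact le_antisymm hx h0

lemma ae_eq_zero_of_integral_exp_mul {μ : Measure ℝ} [IsFiniteMeasure μ] {g : ℝ → ℂ}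
    (hg : Integrable g μ) (h : ∀ t : ℝ, ∫ x, Complex.exp (t * x * Complex.I) * g x ∂μ = 0) :
    g =ᵐ[μ] 0 := by
  have hint : ∀ (t : ℝ) {k : ℝ → ℂ}, Integrable k μ →
      Integrable (fun x : ℝ => Complex.exp (t * x * Complex.I) * k x) μ := fun t k hk =>
    hk.bdd_mul (c := 1) (by fun_prop) (ae_of_all _ fun x => by
      rw [← Complex.ofReal_mul, Complex.norm_exp_ofReal_mul_I])
  have hconj : ∀ t : ℝ,
      ∫ x, Complex.exp (t * x * Complex.I) * (starRingEnd ℂ) (g x) ∂μ = 0 := by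
    intro t
    have h1 := congrArg (starRingEnd ℂ) (h (-t))
    rw [← integral_conj, map_zero] at h1
    rw [← h1]
    refine integral_congr_ae (ae_of_all _ fun x => ?_)
    dsimp only
    rw [map_mul, ← Complex.exp_conj]
    simp
  have hgc : Integrable (fun x => (starRingEnd ℂ) (g x)) μ :=
    (LinearIsometryEquiv.integrable_comp_iff Complex.conjLIE).mpr hg
  have hre := ae_eq_zero_of_integral_exp_mul_ofReal hg.re fun t => by
    have h1 : ∀ x : ℝ, Complex.exp (t * x * Complex.I) * ((RCLike.re (g x) : ℝ) : ℂ) =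
        2⁻¹ * (Complex.exp (t * x * Complex.I) * g x +
          Complex.exp (t * x * Complex.I) * (starRingEnd ℂ) (g x)) := fun x => by
      rw [RCLike.re_to_complex, Complex.re_eq_add_conj]; ring
    simp_rw [h1]
    rw [integral_const_mul, integral_add (hint t hg) (hint t hgc), h, hconj]
    simp
  have him := ae_eq_zero_of_integral_exp_mul_ofReal hg.im fun t => by
    have h1 : ∀ x : ℝ, Complex.exp (t * x * Complex.I) * ((RCLike.im (g x) : ℝ) : ℂ) =
        (2 * Complex.I)⁻¹ * (Complex.exp (t * x * Complex.I) * g x -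
          Complex.exp (t * x * Complex.I) * (starRingEnd ℂ) (g x)) := fun x => by
      rw [RCLike.im_to_complex, Complex.im_eq_sub_conj]; ring
    simp_rw [h1]
    rw [integral_const_mul, integral_sub (hint t hg) (hint t hgc), h, hconj]
    simp
  filter_upwards [hre, him] with x h1 h2
  exact Complex.ext h1 h2

/-- The exponential `x ↦ exp(-2πi t x)` as an element of `L²(μ)`. -/
noncomputable def expLp (μ : Measure ℝ) [IsFiniteMeasure μ] (t : ℝ) : Lp ℂ 2 μ :=
  MemLp.toLp (fun x : ℝ => Complex.exp (-2 * Real.pi * Complex.I * (t : ℂ) * (x : ℂ)))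
    (MemLp.of_bound (C := 1) (by fun_prop) (ae_of_all _ fun x => by
      rw [show (-2 * Real.pi * Complex.I * (t : ℂ) * (x : ℂ)) =
        ((-2 * Real.pi * t * x : ℝ) : ℂ) * Complex.I by push_cast; ring,
        Complex.norm_exp_ofReal_mul_I]))

lemma coeFn_expLp (μ : Measure ℝ) [IsFiniteMeasure μ] (t : ℝ) :
    (expLp μ t : ℝ → ℂ) =ᵐ[μ] fun x : ℝ =>
      Complex.exp (-2 * Real.pi * Complex.I * (t : ℂ) * (x : ℂ)) :=
  MemLp.coeFn_toLp _

lemma inner_expLp_left (μ : Measure ℝ) [IsFiniteMeasure μ] (t : ℝ) (g : Lp ℂ 2 μ) :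
    inner ℂ (expLp μ t) g =
      ∫ x, Complex.exp ((2 * Real.pi * t : ℝ) * x * Complex.I) * g x ∂μ := by
  rw [L2.inner_def]
  refine integral_congr_ae ?_
  filter_upwards [coeFn_expLp μ t] with x hx
  rw [hx, RCLike.inner_apply, mul_comm, ← Complex.exp_conj]
  congr 2
  simp only [map_mul, map_neg, Complex.conj_ofReal, Complex.conj_I, map_ofNat]
  push_cast
  ring

lemma inner_expLp_expLp (μ : Measure ℝ) [IsFiniteMeasure μ] (s t : ℝ) :
    inner ℂ (expLp μ s) (expLp μ t) = charFun μ (-(2 * Real.pi * (t - s))) := by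
  rw [inner_expLp_left, charFun_apply_real]
  refine integral_congr_ae ?_
  filter_upwards [coeFn_expLp μ t] with x hx
  rw [hx, ← Complex.exp_add]
  congr 1
  push_cast
  ring

lemma eq_zero_of_inner_expLp {μ : Measure ℝ} [IsFiniteMeasure μ] {g : Lp ℂ 2 μ}
    (h : ∀ t, inner ℂ (expLp μ t) g = 0) : g = 0 := by
  rw [Lp.eq_zero_iff_ae_eq_zero]
  have hpi := Real.pi_pos.ne'
  refine ae_eq_zero_of_integral_exp_mul ((Lp.memLp g).integrable (by norm_num)) fun t => ?_
  rw [← h (t / (2 * Real.pi)), inner_expLp_left, mul_div_cancel₀ t (mul_ne_zero two_ne_zero hpi)]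

/-- The criterion of Jorgensen and Pedersen: `Λ` is a spectrum of `μ` as soon as
`∑_{t ∈ Λ} |μ̂(ξ + t)|² = 1` for every real `ξ`. -/
lemma isSpectralMeasure_of_hasSum {μ : Measure ℝ} [IsProbabilityMeasure μ] {Λ : Set ℝ}
    (hΛ : Λ.Countable)
    (h : ∀ ξ : ℝ, HasSum (fun t : Λ => ‖charFun μ (-(2 * Real.pi * (ξ + t)))‖ ^ 2) 1) :
    IsSpectralMeasure μ := by
  classical
  have hself : ∀ t, inner ℂ (expLp μ t) (expLp μ t) = 1 := fun t => by
    rw [inner_expLp_expLp]; simp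
  have hnorm : ∀ t, ‖expLp μ t‖ = 1 := fun t => by
    have h2 : ‖expLp μ t‖ ^ 2 = 1 := by
      rw [← inner_self_eq_norm_sq (𝕜 := ℂ), hself, RCLike.one_re]
    exact (pow_eq_one_iff_of_nonneg (norm_nonneg _) two_ne_zero).mp h2
  have hon : Orthonormal ℂ fun t : Λ => expLp μ t := by
    refine ⟨fun t => hnorm t, fun s t hst => ?_⟩
    -- at `ξ = -s` the term of index `s` is already `1`
    have h1 := sum_le_hasSum {s, t} (fun _ _ => sq_nonneg _) (h (-s))
    rw [Finset.sum_pair hst, neg_add_cancel] at h1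
    simp only [mul_zero, neg_zero, charFun_zero, probReal_univ, Complex.ofReal_one, norm_one,
      one_pow, add_le_iff_nonpos_right] at h1
    show inner ℂ (expLp μ s) (expLp μ t) = 0
    rw [inner_expLp_expLp, sub_eq_neg_add]
    exact norm_eq_zero.mp (pow_eq_zero_iff two_ne_zero |>.mp (le_antisymm h1 (sq_nonneg _)))
  have hbot : (Submodule.span ℂ (Set.range fun t : Λ => expLp μ t))ᗮ = ⊥ := by
    rw [Submodule.eq_bot_iff]
    intro g hg
    have hg' : ∀ t : Λ, inner ℂ (expLp μ t) g = 0 := fun t =>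
      (Submodule.mem_orthogonal _ g).mp hg _ (Submodule.subset_span ⟨t, rfl⟩)
    refine eq_zero_of_inner_expLp fun ξ => inner_eq_zero_of_hasSum_norm_sq hon ?_ hg'
    rw [hnorm, one_pow]
    refine (h (-ξ)).congr_fun fun t => ?_
    rw [inner_expLp_expLp, neg_add_eq_sub]
  refine ⟨Λ, hΛ, HilbertBasis.mkOfOrthogonalEqBot hon hbot, fun t => ?_⟩
  rw [HilbertBasis.coe_mkOfOrthogonalEqBot]
  exact coeFn_expLp μ t

/-! ### Passage to the limit -/

/-- For infinitely many `m` the factors of index `≥ m` lose at most a fixed factor, on a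
neighbourhood of a full period of `F_m`. -/
lemma exists_mul_norm_maskProd_le {N : ℕ → ℤ} (hN : ∀ n, 2 ≤ N n) {B : ℕ → Finset ℤ}
    (hB : ∀ n, (B n).Nonempty) (hR : RemainderBounded N B) {φ : ℕ → ℕ} (hφ : StrictMono φ)
    (h : PartialConcentration (N ∘ φ) (B ∘ φ)) :
    ∃ ε > 0, ∃ δ > 0, ∃ᶠ m in atTop, ∀ ξ : ℝ, |ξ| ≤ (1 / 2 + δ) * modulus N m →
      ∀ n ≥ m + 1, ε * ‖maskProd N B m ξ‖ ≤ ‖maskProd N B n ξ‖ := by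
  have hN0 : ∀ n, 0 < N n := fun n => by have := hN n; omega
  obtain ⟨ε, hε, δ, hδ, hk⟩ := h.exists_le_norm_mask hN0 hB hR hφ
  refine ⟨ε / 4, by positivity, min δ (1 / 10), by positivity, ?_⟩
  refine hφ.tendsto_atTop.frequently (Eventually.frequently ?_)
  have htail := ((tendsto_add_atTop_nat 1).comp hφ.tendsto_atTop).eventually
    (quarter_le_norm_prod_Ico hN hB hR)
  filter_upwards [hk, htail] with k h1 h2 ξ hξ n hn
  set m := φ k with hm
  have hP : (0 : ℝ) < modulus N m := by exact_mod_cast modulus_pos hN0 m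
  have hNm : (2 : ℝ) ≤ N m := by exact_mod_cast hN m
  have hsucc : (modulus N (m + 1) : ℝ) = modulus N m * N m := by
    rw [modulus_succ, Int.cast_mul]
  have h3 : ε ≤ ‖mask (B m) (ξ / modulus N (m + 1))‖ := by
    rw [hsucc, ← div_div]
    refine h1 _ ?_
    rw [abs_div, abs_of_pos hP, div_le_iff₀ hP]
    exact hξ.trans (by gcongr; exact min_le_left _ _)
  have h4 : 1 / 4 ≤ ‖∏ i ∈ Finset.Ico (m + 1) n, mask (B i) (ξ / modulus N (i + 1))‖ := by
    refine h2 ξ ?_ n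
    change |ξ| ≤ 3 / 10 * modulus N (m + 1)
    rw [hsucc]
    have : min δ (1 / 10) ≤ 1 / 10 := min_le_right _ _
    nlinarith
  rw [maskProd_eq_mul_prod_Ico N B hn, maskProd_succ, norm_mul, norm_mul]
  calc ε / 4 * ‖maskProd N B m ξ‖ = ‖maskProd N B m ξ‖ * ε * (1 / 4) := by ring
    _ ≤ _ := by gcongr

lemma exists_isLevelSpectrum_seq {N : ℕ → ℤ} (hN : ∀ n, 2 ≤ N n) {B : ℕ → Finset ℤ}
    (hadm : ∀ n, IsAdmissiblePair (N n) (B n)) (hB : ∀ n, (B n).Nonempty) {p : ℕ → Prop}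
    (hp : ∃ᶠ m in atTop, p m) :
    ∃ (M : ℕ → ℕ) (Λ : ℕ → Finset ℤ), StrictMono M ∧ Monotone Λ ∧ ∀ j, p (M j) ∧
      IsLevelSpectrum N B (M j) (Λ j) ∧ ∀ m ∈ Λ j, 2 * |m| ≤ modulus N (M j) := by
  have hN0 : ∀ n, 0 < N n := fun n => by have := hN n; omega
  have hstep : ∀ (n : ℕ) (Λ : Finset ℤ), IsLevelSpectrum N B n Λ → ∃ m > n, p m ∧
      ∃ Λ', Λ ⊆ Λ' ∧ IsLevelSpectrum N B m Λ' ∧ ∀ k ∈ Λ', 2 * |k| ≤ modulus N m := by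
    intro n Λ h
    obtain ⟨m, hm, hpm⟩ := frequently_atTop.mp hp (n + 1 + ∑ k ∈ Λ, 2 * k.natAbs)
    -- `m` is so large that reduction modulo `modulus N m` fixes the elements of `Λ`
    obtain ⟨Λ', hsub, h'⟩ := h.exists_of_le hN0 hadm hB (by omega : n ≤ m)
    obtain ⟨Λ'', hsub', hbd, h''⟩ := h'.exists_reduced hN0 hB hsub fun k hk => by
      have h1 := Finset.single_le_sum (f := fun k : ℤ => 2 * k.natAbs)
        (fun _ _ => Nat.zero_le _) hk
      have h2 : (m : ℤ) < 2 ^ m := by exact_mod_cast Nat.lt_two_pow_self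
      have h3 := two_pow_le_modulus hN m
      rw [Int.abs_eq_natAbs]
      omega
    exact ⟨m, by omega, hpm, Λ'', hsub', h'', hbd⟩
  obtain ⟨m₀, -, hpm₀, Λ₀, -, hΛ₀, hbd₀⟩ := hstep 0 {0} (isLevelSpectrum_zero N B)
  let T := {q : ℕ × Finset ℤ // p q.1 ∧ IsLevelSpectrum N B q.1 q.2 ∧
    ∀ k ∈ q.2, 2 * |k| ≤ modulus N q.1}
  have hnext : ∀ q : T, ∃ q' : T, q.1.1 < q'.1.1 ∧ q.1.2 ⊆ q'.1.2 := by
    rintro ⟨⟨n, Λ⟩, -, hΛ, -⟩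
    obtain ⟨m, hm, hpm, Λ', hsub, hΛ', hbd⟩ := hstep n Λ hΛ
    exact ⟨⟨⟨m, Λ'⟩, hpm, hΛ', hbd⟩, hm, hsub⟩
  choose next hlt hsub using hnext
  let q : ℕ → T := fun j => next^[j] ⟨⟨m₀, Λ₀⟩, hpm₀, hΛ₀, hbd₀⟩
  have hq : ∀ j, q (j + 1) = next (q j) := fun j => Function.iterate_succ_apply' _ _ _
  refine ⟨fun j => (q j).1.1, fun j => (q j).1.2, strictMono_nat_of_lt_succ fun j => ?_,
    monotone_nat_of_le_succ fun j => ?_, fun j => (q j).2⟩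
  · rw [hq]; exact hlt (q j)
  · rw [hq]; exact hsub (q j)

/-- The Parseval identities at the finite levels pass to the limit, by dominated convergence: the
frequencies in `Λ j` shifted by `ξ` eventually lie in the range of the lower bound `hlow`, so
`|F_{M j}(ξ + m)|² ≤ ε⁻² |f(ξ + m)|²`. -/
lemma hasSum_indicator_of_isLevelSpectrum {N : ℕ → ℤ} (hN : ∀ n, 2 ≤ N n) {B : ℕ → Finset ℤ}
    {f : ℝ → ℂ} (hf : ∀ ξ, Tendsto (fun n => maskProd N B n ξ) atTop (𝓝 (f ξ)))
    {ε δ : ℝ} (hε : 0 < ε) (hδ : 0 < δ) {M : ℕ → ℕ} (hM : StrictMono M) {Λ : ℕ → Finset ℤ}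
    (hΛ : Monotone Λ) (hspec : ∀ j, IsLevelSpectrum N B (M j) (Λ j))
    (hsmall : ∀ j, ∀ m ∈ Λ j, 2 * |m| ≤ modulus N (M j))
    (hlow : ∀ j, ∀ ξ : ℝ, |ξ| ≤ (1 / 2 + δ) * modulus N (M j) →
      ∀ n ≥ M j + 1, ε * ‖maskProd N B (M j) ξ‖ ≤ ‖maskProd N B n ξ‖) (ξ : ℝ) :
    HasSum ({m : ℤ | ∃ j, m ∈ Λ j}.indicator fun m => ‖f (ξ + m)‖ ^ 2) 1 := by
  classical
  set g : ℤ → ℝ := {m : ℤ | ∃ j, m ∈ Λ j}.indicator fun m => ‖f (ξ + m)‖ ^ 2 with hg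
  set F : ℕ → ℤ → ℝ := fun j m =>
    if m ∈ Λ j then ‖maskProd N B (M j) (ξ + m)‖ ^ 2 else 0 with hF
  have hF0 : ∀ j m, 0 ≤ F j m := fun j m => by
    rw [hF]; dsimp only; split_ifs <;> positivity
  have hFsum : ∀ j, HasSum (F j) 1 := by
    intro j
    rw [← hspec j ξ, ← Finset.sum_congr rfl fun m (hm : m ∈ Λ j) =>
      (if_pos hm : F j m = ‖maskProd N B (M j) (ξ + m)‖ ^ 2)]
    exact hasSum_sum_of_ne_finset_zero fun m hm => if_neg hm
  have hlim : ∀ m, Tendsto (fun j => F j m) atTop (𝓝 (g m)) := by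
    intro m
    by_cases hm : ∃ j, m ∈ Λ j
    · obtain ⟨j₀, hj₀⟩ := hm
      rw [hg, Set.indicator_of_mem (show m ∈ {m : ℤ | ∃ j, m ∈ Λ j} from ⟨j₀, hj₀⟩)]
      refine (((hf (ξ + m)).comp hM.tendsto_atTop).norm.pow 2).congr' ?_
      filter_upwards [eventually_ge_atTop j₀] with j hj
      exact (if_pos (hΛ hj hj₀)).symm
    · rw [hg, Set.indicator_of_notMem (show m ∉ {m : ℤ | ∃ j, m ∈ Λ j} from hm)]
      exact tendsto_const_nhds.congr fun j => (if_neg fun h => hm ⟨j, h⟩).symm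
  have hg0 : ∀ m, 0 ≤ g m := fun m => Set.indicator_nonneg (fun _ _ => sq_nonneg _) m
  -- Fatou: the finite partial sums of `g` are limits of partial sums which are at most `1`
  have hgsum : Summable g := summable_of_sum_le hg0 fun s =>
    le_of_tendsto' (tendsto_finsetSum s fun m _ => hlim m) fun j =>
      sum_le_hasSum s (fun m _ => hF0 j m) (hFsum j)
  have hdom : ∀ᶠ j in atTop, ∀ m, ‖F j m‖ ≤ (ε ^ 2)⁻¹ * g m := by
    have hbig : Tendsto (fun j => δ * (2 : ℝ) ^ M j) atTop atTop :=
      ((tendsto_pow_atTop_atTop_of_one_lt one_lt_two).comp hM.tendsto_atTop).const_mul_atTop hδ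
    filter_upwards [hbig.eventually_ge_atTop |ξ|] with j hj m
    rw [Real.norm_of_nonneg (hF0 j m)]
    by_cases hm : m ∈ Λ j
    · have hPj : (2 : ℝ) ^ M j ≤ modulus N (M j) := by exact_mod_cast two_pow_le_modulus hN (M j)
      have hle : |ξ + m| ≤ (1 / 2 + δ) * modulus N (M j) := by
        have h1 : 2 * |(m : ℝ)| ≤ modulus N (M j) := by exact_mod_cast hsmall j m hm
        have h2 := mul_le_mul_of_nonneg_left hPj hδ.le
        have h3 := abs_add_le ξ (m : ℝ)
        linarith
      have h4 : ε * ‖maskProd N B (M j) (ξ + m)‖ ≤ ‖f (ξ + m)‖ :=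
        ge_of_tendsto (hf (ξ + m)).norm
          ((eventually_ge_atTop (M j + 1)).mono fun n hn => hlow j _ hle n hn)
      rw [hg, Set.indicator_of_mem (show m ∈ {m : ℤ | ∃ j, m ∈ Λ j} from ⟨j, hm⟩), hF]
      dsimp only
      rw [if_pos hm, le_inv_mul_iff₀ (by positivity), ← mul_pow]
      gcongr
    · rw [hF]
      dsimp only
      rw [if_neg hm]
      exact mul_nonneg (by positivity) (hg0 m)
  have h := tendsto_tsum_of_dominated_convergence (hgsum.mul_left _) hlim hdom
  simp_rw [fun j => (hFsum j).tsum_eq] at h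
  rw [tendsto_nhds_unique tendsto_const_nhds h]
  exact hgsum.hasSum

theorem theorem2p5 (N : ℕ → ℤ) (B : ℕ → Finset ℤ)
    (hpos : ∀ n, 0 < N n)
    (hadm : ∀ n, IsAdmissiblePair (N n) (B n))
    (hrbc : RemainderBounded N B)
    (hpcc : ∃ φ : ℕ → ℕ, StrictMono φ ∧ PartialConcentration (N ∘ φ) (B ∘ φ)) :
    ∃ μ : ProbabilityMeasure ℝ,
      IsInfiniteConvolution N B μ ∧ IsSpectralMeasure (μ : Measure ℝ) := by
  have hN : ∀ n, 2 ≤ N n := fun n => by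
    have h1 := (hadm n).1
    rw [abs_of_pos (hpos n)] at h1
    omega
  have hB : ∀ n, (B n).Nonempty := fun n => Finset.card_pos.mp (by have := (hadm n).2.1; omega)
  obtain ⟨φ, hφ, hpc⟩ := hpcc
  obtain ⟨μ, hμ, hlim⟩ := exists_isInfiniteConvolution hN hB hrbc
  obtain ⟨ε, hε, δ, hδ, hfreq⟩ := exists_mul_norm_maskProd_le hN hB hrbc hφ hpc
  obtain ⟨M, Λ, hM, hΛ, hj⟩ := exists_isLevelSpectrum_seq hN hadm hB hfreq
  refine ⟨μ, hμ, isSpectralMeasure_of_hasSum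
    (Λ := ((↑) : ℤ → ℝ) '' {m : ℤ | ∃ j, m ∈ Λ j}) ((Set.to_countable _).image _) fun ξ => ?_⟩
  have h := hasSum_indicator_of_isLevelSpectrum hN hlim hε hδ hM hΛ (fun j => (hj j).2.1)
    (fun j => (hj j).2.2) (fun j => (hj j).1) ξ
  rw [← hasSum_subtype_iff_indicator] at h
  exact (Equiv.hasSum_iff (Equiv.Set.image _ _ Int.cast_injective)).mp h
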